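/- All functions below take values in $\mathbb{R}\cup\{\pm\infty\}$. A function $f$ on $\mathbb{R}^n$ is proper if it never equals $-\infty$ and is not identically $+\infty$; it is closed if it is lower semicontinuous; $\operatorname{dom} f=\{x: f(x)<+\infty\}$. A polyhedron is an intersection of finitely many closed half-spaces, and a polyhedral function is one whose epigraph is a polyhedron. $\partial f(x)$ denotes the limiting subdifferential of $f$ at a point $x$ where $f$ is finite: the set of all limits of sequences $v^k$ such that, for some $x^k\to x$ with $f(x^k)\to f(x)$, each $f(x^k)$ is finite and $f(y)\ge f(x^k)+\langle v^k,y-x^k\rangle+o(\|y-x^k\|)$ as $y\to x^k$. Moreover $\operatorname{dom}\partial f=\{x:\partial f(x)\neq\emptyset\}$. A proper closed function $f$ is called a (two-sided) KL function with exponent $\theta\in[0,1)$ if for every $\bar x\in\operatorname{dom}\partial f$ there are a neighborhood $E$ of $\bar x$ and numbers $\kappa,\eta\in(0,\infty)$ such that $$\|g\|\ \ge\ \kappa\,|f(x)-f(\bar x)|^{\theta}$$ for all $x\in E$ with $f(\bar x)-\eta<f(x)<f(\bar x)+\eta$ and all $g\in\partial f(x)$. **Theorem.** Let $A\in\mathbb{R}^{m\times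 n}$, let $r_1,\dots,r_N$ be proper closed polyhedral functions on $\mathbb{R}^n$, let $l$ be a function on $\mathbb{R}^m$, and suppose that $$u(x)=\min_{1\le i\le N}\{\,l(Ax)+r_i(x)\,\}$$ is a proper closed function on $\mathbb{R}^n$. Suppose that $l$ satisfies one of the following two conditions: (a) $l$ is a proper closed convex function with open domain, it is strongly convex on every compact convex subset of $\operatorname{dom} l$, and it is twice continuously differentiable on $\operatorname{dom} l$; (b) $l(y)=\max_{z\in D}\{\langle y,z\rangle-q(z)\}$ for all $y\in\mathbb{R}^m$, where $D\subseteq\mathbb{R}^m$ is a polyhedron and $q:\mathbb{R}^m\to\mathbb{R}$ is strongly convex and differentiable with Lipschitz continuous gradient. Suppose in addition that the restriction of $u$ to $\operatorname{dom}\partial u$ is continuous. Then $u$ is a (two-sided) KL function with exponent $1/2$. -/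

import Mathlib

open Filter Topology

/-- The effective domain `{x | f x < +∞}` of an extended-real-valued function. -/
def effDom {E : Type*} (f : E → EReal) : Set E := {x | f x < ⊤}

/-- A proper function: never `-∞`, and not identically `+∞`. -/
def IsProperFun {E : Type*} (f : E → EReal) : Prop :=
  (∃ x, f x < ⊤) ∧ ∀ x, f x ≠ ⊥

/-- A closed function, that is, a lower semicontinuous one. -/
def IsClosedFun {E : Type*} [TopologicalSpace E] (f : E → EReal) : Prop :=
  LowerSemicontinuous f

/-- The epigraph of an extended-real-valued function. -/
def epiGraph {E : Type*} (f : E → EReal) : Set (E × ℝ) := {p | f p.1 ≤ (p.2 : EReal)}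

/-- A convex extended-real-valued function: its epigraph is convex. -/
def IsConvexFun {E : Type*} [AddCommGroup E] [Module ℝ E] (f : E → EReal) : Prop :=
  Convex ℝ (epiGraph f)

/-- A polyhedron: the intersection of finitely many closed half-spaces. -/
def IsPolyhedron {E : Type*} [AddCommGroup E] [Module ℝ E] (s : Set E) : Prop :=
  ∃ (k : ℕ) (a : Fin k → E →ₗ[ℝ] ℝ) (b : Fin k → ℝ), s = {x | ∀ j, a j x ≤ b j}

/-- A polyhedral function: its epigraph is a polyhedron. -/
def IsPolyhedralFun {E : Type*} [AddCommGroup E] [Module ℝ E] (f : E → EReal) : Prop :=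
  IsPolyhedron (epiGraph f)

section Subdifferential

variable {E : Type*} [NormedAddCommGroup E] [InnerProductSpace ℝ E]

/-- The regular (Fréchet) subdifferential: `v` belongs to it at a point `x` where `f` is finite
iff `f y ≥ f x + ⟪v, y - x⟫ + o(‖y - x‖)` as `y → x`. -/
def regularSubdiff (f : E → EReal) (x : E) : Set E :=
  {v | f x ≠ ⊤ ∧ f x ≠ ⊥ ∧ ∀ ε : ℝ, 0 < ε → ∀ᶠ y in 𝓝 x,
    (((f x).toReal + inner ℝ v (y - x) - ε * ‖y - x‖ : ℝ) : EReal) ≤ f y}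

/-- The limiting (Mordukhovich) subdifferential: limits of regular subgradients at points that
converge to `x` together with their function values. -/
def limitingSubdiff (f : E → EReal) (x : E) : Set E :=
  {v | f x ≠ ⊤ ∧ f x ≠ ⊥ ∧ ∃ (xs vs : ℕ → E),
    Tendsto xs atTop (𝓝 x) ∧ Tendsto (fun k => f (xs k)) atTop (𝓝 (f x)) ∧
    (∀ k, vs k ∈ regularSubdiff f (xs k)) ∧ Tendsto vs atTop (𝓝 v)}

/-- The domain of the limiting subdifferential. -/
def domSubdiff (f : E → EReal) : Set E := {x | (limitingSubdiff f x).Nonempty}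

/-- The two-sided KL inequality for `f` at the point `xbar` of its domain, with exponent `θ`. -/
def HasTwoSidedKLAt (f : E → EReal) (θ : ℝ) (xbar : E) : Prop :=
  xbar ∈ effDom f ∧
  ∃ U ∈ 𝓝 xbar, ∃ κ η : ℝ, 0 < κ ∧ 0 < η ∧
    ∀ x ∈ U, f xbar - (η : EReal) < f x → f x < f xbar + (η : EReal) →
      ∀ g ∈ limitingSubdiff f x, κ * |(f x).toReal - (f xbar).toReal| ^ θ ≤ ‖g‖

/-- `f` is a KL function (in the two-sided sense) with exponent `θ ∈ [0, 1)`. -/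
def IsTwoSidedKLFun (f : E → EReal) (θ : ℝ) : Prop :=
  IsProperFun f ∧ IsClosedFun f ∧ 0 ≤ θ ∧ θ < 1 ∧
    ∀ xbar ∈ domSubdiff f, HasTwoSidedKLAt f θ xbar

/-- `l` is a proper closed convex function with open domain, twice continuously differentiable
there, and strongly convex on every compact convex subset of the domain (with a modulus that may
depend on the subset). -/
def IsLocallyStronglyConvexLoss (l : E → EReal) : Prop :=
  IsProperFun l ∧ IsClosedFun l ∧ IsConvexFun l ∧ IsOpen (effDom l) ∧
  (∀ K : Set E, K ⊆ effDom l → IsCompact K → Convex ℝ K →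
    ∃ σ : ℝ, 0 < σ ∧ StrongConvexOn K σ (fun y => (l y).toReal)) ∧
  ContDiffOn ℝ 2 (fun y => (l y).toReal) (effDom l)

/-- `l y = max_{z ∈ D} (⟪y, z⟫ - q z)` for all `y`, with `D` a polyhedron and `q` strongly convex
and differentiable with Lipschitz continuous gradient. (The maximum being attained, `D` is
nonempty; the derivative `fderiv ℝ q` has the same Lipschitz constants as the gradient.) -/
def IsConjugateTypeLoss (l : E → EReal) : Prop :=
  ∃ (D : Set E) (q : E → ℝ),
    IsPolyhedron D ∧
    (∃ σ : ℝ, 0 < σ ∧ StrongConvexOn Set.univ σ q) ∧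
    Differentiable ℝ q ∧ (∃ L : NNReal, LipschitzWith L (fderiv ℝ q)) ∧
    ∀ y, IsGreatest ((fun z => ((inner ℝ y z - q z : ℝ) : EReal)) '' D) (l y)

end Subdifferential

/-! ### Hoffman's error bound and its consequences. -/

section Hoffman

/-! Each piece `F i = l ∘ A + r i` is closed and convex, and a limiting subgradient of the minimum
`u` is a convex subgradient of some active piece (`exists_active_subgradient`). So it suffices to
bound the subgradients of one piece near `x₀`, at values close to `M = u x₀`
(`exists_kl_bound_of_piece`). If `F i x₀ > M`, lower semicontinuity keeps the values of the piece
away from `M`. If `M` is attained at `x₀` but is not the minimum of the piece, a point with a lower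
value keeps subgradients away from `0`.

If `M` is the minimum, the distance to the minimizers is at most `K * √(F i x - M)`; inserting a
near minimizer in the subgradient inequality gives `F i x - M ≤ ‖g‖ * K * √(F i x - M)`, whence the
exponent `1/2`.

This distance bound rests on `HasPolyhedralGrowthAt`, which both kinds of loss satisfy: modulo its
linearization, `l` grows like the squared distance to a translated finitely generated cone. The
minimizers then contain a polyhedron, and Hoffman's bound controls the distance to it by residuals
of order `√(F i x - M)`. -/

theorem exists_mul_norm_le_sum_of_polar {E ι : Type*} [NormedAddCommGroup E]
    [InnerProductSpace ℝ E] [FiniteDimensional ℝ E] (J : Finset ι) (a : ι → E →ₗ[ℝ] ℝ) :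
    ∃ ε : ℝ, 0 < ε ∧ ∀ d : E, (∀ v, (∀ j ∈ J, a j v ≤ 0) → inner ℝ d v ≤ 0) →
      ε * ‖d‖ ≤ ∑ j ∈ J, max (a j d) 0 := by
  set P : Set E := {d | ∀ v, (∀ j ∈ J, a j v ≤ 0) → inner ℝ d v ≤ 0} with hP
  have hPc : IsClosed P := by
    have : P = ⋂ v, ⋂ (_ : ∀ j ∈ J, a j v ≤ 0), {d | inner ℝ d v ≤ 0} := by
      ext d; simp [hP]
    rw [this]
    exact isClosed_iInter fun v => isClosed_iInter fun _ =>
      isClosed_le (by fun_prop) continuous_const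
  have hK : IsCompact (Metric.sphere (0 : E) 1 ∩ P) := (isCompact_sphere 0 1).inter_right hPc
  have hφ : Continuous fun d : E => ∑ j ∈ J, max (a j d) 0 :=
    continuous_finsetSum _ fun j _ =>
      ((a j).continuous_of_finiteDimensional).max continuous_const
  have hnorm : ∀ d ∈ P, d ≠ 0 → ‖d‖⁻¹ • d ∈ Metric.sphere (0 : E) 1 ∩ P := by
    intro d hd h0
    refine ⟨by simp [norm_smul, h0], fun v hv => ?_⟩
    rw [real_inner_smul_left]
    exact mul_nonpos_of_nonneg_of_nonpos (by positivity) (hd v hv)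
  have hsum : ∀ d : E, 0 ≤ ∑ j ∈ J, max (a j d) 0 := fun d =>
    Finset.sum_nonneg fun j _ => le_max_right _ _
  rcases (Metric.sphere (0 : E) 1 ∩ P).eq_empty_or_nonempty with he | hne
  · refine ⟨1, one_pos, fun d hd => ?_⟩
    by_cases h0 : d = 0
    · simp [h0]
    · have := hnorm d hd h0
      simp [he] at this
  · obtain ⟨d₀, hd₀, hmin⟩ := hK.exists_isMinOn hne hφ.continuousOn
    refine ⟨∑ j ∈ J, max (a j d₀) 0, lt_of_le_of_ne (hsum d₀) fun h => ?_, fun d hd => ?_⟩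
    -- A zero minimum would put the unit vector `d₀` both in the cone and in its polar, so that
    -- `⟪d₀, d₀⟫ ≤ 0`.
    · have h1 : ∀ j ∈ J, a j d₀ ≤ 0 := fun j hj => by
        have := (Finset.sum_eq_zero_iff_of_nonneg
          (fun j _ => le_max_right (a j d₀) 0)).1 h.symm j hj
        simpa using this
      have h2 := hd₀.2 d₀ h1
      have h3 : ‖d₀‖ = 1 := by simpa using hd₀.1
      rw [real_inner_self_eq_norm_sq, h3] at h2
      norm_num at h2
    · by_cases h0 : d = 0
      · simp [h0]
      · have h1 := isMinOn_iff.1 hmin _ (hnorm d hd h0)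
        have hpos : 0 < ‖d‖ := norm_pos_iff.2 h0
        have h2 : ∑ j ∈ J, max (a j (‖d‖⁻¹ • d)) 0 = ‖d‖⁻¹ * ∑ j ∈ J, max (a j d) 0 := by
          rw [Finset.mul_sum]
          refine Finset.sum_congr rfl fun j _ => ?_
          rw [map_smul, smul_eq_mul, mul_max_of_nonneg _ _ (by positivity), mul_zero]
        rw [h2] at h1
        calc _ ≤ (‖d‖⁻¹ * ∑ j ∈ J, max (a j d) 0) * ‖d‖ := by gcongr
          _ = _ := by field_simp

/-- Inactive constraints have slack at `x`, so only the active ones restrict short steps: tangent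
directions are feasible up to a uniform length. -/
theorem exists_pos_forall_feasible_add {E ι : Type*} [NormedAddCommGroup E] [NormedSpace ℝ E]
    [FiniteDimensional ℝ E] [Finite ι] (a : ι → E →ₗ[ℝ] ℝ) (b : ι → ℝ) {x : E}
    (hx : ∀ j, a j x ≤ b j) :
    ∃ ρ : ℝ, 0 < ρ ∧ ∀ v : E, (∀ j, a j x = b j → a j v ≤ 0) → ‖v‖ ≤ ρ →
      ∀ j, a j (x + v) ≤ b j := by
  have h : ∀ᶠ v : E in 𝓝 0, ∀ j, a j x ≠ b j → a j v < b j - a j x := by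
    refine eventually_all.2 fun j => ?_
    by_cases hj : a j x = b j
    · simp [hj]
    · have hc : Tendsto (a j) (𝓝 0) (𝓝 (a j 0)) :=
        (a j).continuous_of_finiteDimensional.tendsto 0
      rw [map_zero] at hc
      filter_upwards [hc.eventually_lt_const (sub_pos.2 (lt_of_le_of_ne (hx j) hj))] with v hv _
      exact hv
  obtain ⟨ρ, hρ, H⟩ := Metric.eventually_nhds_iff.1 h
  refine ⟨ρ / 2, by positivity, fun v hv hn j => ?_⟩
  rw [map_add]
  by_cases hj : a j x = b j
  · linarith [hv j hj]
  · have := H (y := v) (by rw [dist_zero_right]; linarith) j hj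
    linarith

/-- If `x'` is the projection of `x`, then `x - x'` is polar to the cone of the constraints active
at `x'`, and there `a j (x - x')` is exactly the residual `a j x - b j`. -/
theorem hoffman_of_innerProductSpace {E ι : Type*} [NormedAddCommGroup E]
    [InnerProductSpace ℝ E] [FiniteDimensional ℝ E] [Fintype ι] (a : ι → E →ₗ[ℝ] ℝ) :
    ∃ C : ℝ, 0 < C ∧ ∀ b : ι → ℝ, (∃ z, ∀ j, a j z ≤ b j) → ∀ x, ∃ x', (∀ j, a j x' ≤ b j) ∧
      ‖x - x'‖ ≤ C * ∑ j, max (a j x - b j) 0 := by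
  classical
  -- One constant for each possible active set; there are finitely many, and `b` only decides which
  -- one occurs.
  choose ε hε hbd using fun J : Finset ι => exists_mul_norm_le_sum_of_polar J a
  have hCpos : 0 < ∑ J, (ε J)⁻¹ :=
    Finset.sum_pos (fun J _ => inv_pos.2 (hε J)) Finset.univ_nonempty
  refine ⟨∑ J, (ε J)⁻¹, hCpos, fun b hne x => ?_⟩
  set S : Set E := {z | ∀ j, a j z ≤ b j} with hS
  have hSc : IsClosed S := by
    have : S = ⋂ j, {z | a j z ≤ b j} := by ext; simp [hS]
    rw [this]
    exact isClosed_iInter fun j =>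
      isClosed_le (a j).continuous_of_finiteDimensional continuous_const
  have hSconv : Convex ℝ S := by
    intro y hy z hz s t hs ht hst j
    rw [map_add, map_smul, map_smul, smul_eq_mul, smul_eq_mul]
    calc s * a j y + t * a j z ≤ s * b j + t * b j := by
          gcongr
          · exact hy j
          · exact hz j
      _ = b j := by rw [← add_mul, hst, one_mul]
  obtain ⟨x', hx', hmin⟩ := exists_norm_eq_iInf_of_complete_convex (K := S) hne hSc.isComplete hSconv x
  rw [norm_eq_iInf_iff_real_inner_le_zero hSconv hx'] at hmin
  refine ⟨x', hx', ?_⟩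
  obtain ⟨ρ, hρ, hfeas⟩ := exists_pos_forall_feasible_add a b hx'
  set J : Finset ι := Finset.univ.filter fun j => a j x' = b j with hJ
  have hpol : ∀ v, (∀ j ∈ J, a j v ≤ 0) → inner ℝ (x - x') v ≤ 0 := by
    intro v hv
    have hs : 0 < ρ / (‖v‖ + 1) := by positivity
    have h1 : x' + (ρ / (‖v‖ + 1)) • v ∈ S := by
      refine hfeas _ (fun j hj => ?_) ?_
      · rw [map_smul, smul_eq_mul]
        exact mul_nonpos_of_nonneg_of_nonpos hs.le (hv j (by simp [hJ, hj]))
      · rw [norm_smul, Real.norm_of_nonneg hs.le, div_mul_eq_mul_div, div_le_iff₀ (by positivity)]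
        gcongr
        linarith
    have h2 := hmin _ h1
    rw [add_sub_cancel_left, real_inner_smul_right] at h2
    exact nonpos_of_mul_nonpos_right h2 hs
  have h1 := hbd J (x - x') hpol
  have h2 : ∑ j ∈ J, max (a j (x - x')) 0 ≤ ∑ j, max (a j x - b j) 0 := by
    calc _ = ∑ j ∈ J, max (a j x - b j) 0 := by
          refine Finset.sum_congr rfl fun j hj => ?_
          rw [map_sub, (Finset.mem_filter.1 hj).2]
      _ ≤ _ := Finset.sum_le_sum_of_subset_of_nonneg (Finset.subset_univ _)
          fun j _ _ => le_max_right _ _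
  have h3 : (ε J)⁻¹ ≤ ∑ J, (ε J)⁻¹ :=
    Finset.single_le_sum (f := fun J => (ε J)⁻¹) (fun J _ => (inv_pos.2 (hε J)).le)
      (Finset.mem_univ J)
  have h4 : 0 ≤ ∑ j, max (a j x - b j) 0 := Finset.sum_nonneg fun j _ => le_max_right _ _
  calc ‖x - x'‖ = (ε J)⁻¹ * (ε J * ‖x - x'‖) := by
        rw [inv_mul_cancel_left₀ (hε J).ne']
    _ ≤ (ε J)⁻¹ * ∑ j, max (a j x - b j) 0 :=
        mul_le_mul_of_nonneg_left (h1.trans h2) (inv_pos.2 (hε J)).le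
    _ ≤ _ := by gcongr

/-- **Hoffman's error bound**, with a constant that does not depend on the right-hand side. -/
theorem hoffman {E ι : Type*} [NormedAddCommGroup E] [NormedSpace ℝ E] [FiniteDimensional ℝ E]
    [Fintype ι] (a : ι → E →ₗ[ℝ] ℝ) :
    ∃ C : ℝ, 0 < C ∧ ∀ b : ι → ℝ, (∃ z, ∀ j, a j z ≤ b j) → ∀ x, ∃ x', (∀ j, a j x' ≤ b j) ∧
      ‖x - x'‖ ≤ C * ∑ j, max (a j x - b j) 0 := by
  let e : E ≃L[ℝ] EuclideanSpace ℝ (Fin (Module.finrank ℝ E)) :=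
    ContinuousLinearEquiv.ofFinrankEq (by simp)
  set e' : EuclideanSpace ℝ (Fin (Module.finrank ℝ E)) →L[ℝ] E :=
    e.symm.toContinuousLinearMap with he'
  obtain ⟨C, hC, H⟩ := hoffman_of_innerProductSpace
    fun j => (a j).comp e'.toLinearMap
  set M := ‖e'‖
  refine ⟨(M + 1) * C, by positivity, fun b ⟨z, hz⟩ x => ?_⟩
  obtain ⟨w, hw, hle⟩ := H b ⟨e z, fun j => by simpa [he'] using hz j⟩ (e x)
  refine ⟨e.symm w, fun j => hw j, ?_⟩
  have h1 : ‖x - e.symm w‖ ≤ M * ‖e x - w‖ := by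
    have := e'.le_opNorm (e x - w)
    simpa [he'] using this
  simp only [LinearMap.comp_apply, ContinuousLinearMap.coe_coe, he',
    ContinuousLinearEquiv.coe_coe,    ContinuousLinearEquiv.symm_apply_apply] at hle
  calc _ ≤ M * ‖e x - w‖ := h1
    _ ≤ (M + 1) * ‖e x - w‖ := by gcongr; linarith
    _ ≤ (M + 1) * (C * ∑ j, max (a j x - b j) 0) := by gcongr
    _ = _ := by ring

/-- Error bound for the intersection of a polyhedron with an affine subspace and a half-space,
at the points of the polyhedron. -/
theorem IsPolyhedron.exists_error_bound {E : Type*} [NormedAddCommGroup E] [NormedSpace ℝ E]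
    [FiniteDimensional ℝ E] {P : Set E} (hP : IsPolyhedron P) {m : ℕ}
    (M : E →ₗ[ℝ] EuclideanSpace ℝ (Fin m)) (f : E →ₗ[ℝ] ℝ) :
    ∃ C : ℝ, 0 < C ∧ ∀ (w : EuclideanSpace ℝ (Fin m)) (β : ℝ),
      (∃ p ∈ P, M p = w ∧ f p ≤ β) → ∀ p ∈ P, ∃ p' ∈ P, M p' = w ∧ f p' ≤ β ∧
        ‖p - p'‖ ≤ C * (‖M p - w‖ + max (f p - β) 0) := by
  obtain ⟨k, a, b, rfl⟩ := hP
  let co : Fin m → E →ₗ[ℝ] ℝ := fun i => (EuclideanSpace.proj i : _ →L[ℝ] ℝ).toLinearMap ∘ₗ M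
  have hco : ∀ i p, co i p = M p i := fun i p => rfl
  obtain ⟨C, hC, H⟩ := hoffman (Sum.elim a (Sum.elim (fun _ : Unit => f)
    (Sum.elim co (fun i => -co i))))
  -- Each of the `m` coordinates of `M p = w` counts as two opposite inequalities; the half-space
  -- gives the remaining one.
  refine ⟨C * (2 * m + 1), by positivity, fun w β ⟨z, hz, hzw, hzf⟩ p hp => ?_⟩
  obtain ⟨p', hp', hle⟩ := H (Sum.elim b (Sum.elim (fun _ => β) (Sum.elim (fun i => w i)
    (fun i => -w i)))) ⟨z, by
      rintro (j | j | j | j)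
      · exact hz j
      · exact hzf
      · simp [hco, hzw]
      · simp [hco, hzw]⟩ p
  refine ⟨p', fun j => hp' (Sum.inl j), ?_, hp' (Sum.inr (Sum.inl ())), hle.trans ?_⟩
  · ext i
    have h1 := hp' (Sum.inr (Sum.inr (Sum.inl i)))
    have h2 := hp' (Sum.inr (Sum.inr (Sum.inr i)))
    simp only [Sum.elim_inr, Sum.elim_inl, hco, LinearMap.neg_apply] at h1 h2
    linarith
  · have hi : ∀ i, |M p i - w i| ≤ ‖M p - w‖ := fun i => by
      simpa using PiLp.norm_apply_le (M p - w) i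
    have s1 : ∑ j, max (a j p - b j) 0 = 0 :=
      Finset.sum_eq_zero fun j _ => max_eq_right (sub_nonpos.2 (hp j))
    have s2 : ∑ i, max (M p i - w i) 0 ≤ m * ‖M p - w‖ := by
      calc _ ≤ ∑ _i : Fin m, ‖M p - w‖ := Finset.sum_le_sum fun i _ =>
            max_le ((le_abs_self _).trans (hi i)) (norm_nonneg _)
        _ = _ := by simp
    have s3 : ∑ i, max (-M p i - -w i) 0 ≤ m * ‖M p - w‖ := by
      calc _ ≤ ∑ _i : Fin m, ‖M p - w‖ := Finset.sum_le_sum fun i _ =>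
            max_le (by linarith [neg_le_abs (M p i - w i), hi i]) (norm_nonneg _)
        _ = _ := by simp
    simp only [Fintype.sum_sum_type, Sum.elim_inl, Sum.elim_inr, hco, LinearMap.neg_apply,
      Finset.univ_unique, Finset.sum_singleton, s1]
    rw [mul_assoc]
    refine mul_le_mul_of_nonneg_left ?_ hC.le
    have h0 : 0 ≤ max (f p - β) 0 := le_max_right _ _
    have hn := norm_nonneg (M p - w)
    have hm : (0 : ℝ) ≤ m := by positivity
    nlinarith

theorem isPolyhedron_of_fintype {E ι : Type*} [AddCommGroup E] [Module ℝ E] [Fintype ι]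
    (a : ι → E →ₗ[ℝ] ℝ) (b : ι → ℝ) : IsPolyhedron {x | ∀ j, a j x ≤ b j} := by
  let e := Fintype.equivFin ι
  refine ⟨Fintype.card ι, fun j => a (e.symm j), fun j => b (e.symm j), ?_⟩
  ext x
  exact ⟨fun h j => h _, fun h j => by simpa using h (e j)⟩

theorem IsPolyhedron.prod {E F : Type*} [AddCommGroup E] [Module ℝ E] [AddCommGroup F]
    [Module ℝ F] {s : Set E} {t : Set F} (hs : IsPolyhedron s) (ht : IsPolyhedron t) :
    IsPolyhedron (s ×ˢ t) := by
  obtain ⟨k, a, b, rfl⟩ := hs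
  obtain ⟨k', a', b', rfl⟩ := ht
  convert isPolyhedron_of_fintype (E := E × F)
    (Sum.elim (fun j => a j ∘ₗ LinearMap.fst ℝ E F) (fun j => a' j ∘ₗ LinearMap.snd ℝ E F))
    (Sum.elim b b') using 1
  ext ⟨x, y⟩
  simp

theorem isPolyhedron_nonneg (k : ℕ) : IsPolyhedron {c : Fin k → ℝ | 0 ≤ c} := by
  refine ⟨k, fun j => -LinearMap.proj j, 0, ?_⟩
  ext c
  simp [Pi.le_def]

theorem IsPolyhedron.convex {E : Type*} [AddCommGroup E] [Module ℝ E] {s : Set E}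
    (hs : IsPolyhedron s) : Convex ℝ s := by
  obtain ⟨k, a, b, rfl⟩ := hs
  intro y hy z hz s t hs ht hst j
  rw [map_add, map_smul, map_smul, smul_eq_mul, smul_eq_mul]
  calc s * a j y + t * a j z ≤ s * b j + t * b j := by
        gcongr
        · exact hy j
        · exact hz j
    _ = b j := by rw [← add_mul, hst, one_mul]

/-- Finitely generated cones are closed. -/
theorem isClosed_image_nonneg {k m : ℕ} (B : (Fin k → ℝ) →ₗ[ℝ] EuclideanSpace ℝ (Fin m)) :
    IsClosed (B '' {c | 0 ≤ c}) := by
  obtain ⟨C, hC, H⟩ := (isPolyhedron_nonneg k).exists_error_bound B 0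
  have hB : Continuous B := B.continuous_of_finiteDimensional
  refine isClosed_of_closure_subset fun y hy => ?_
  obtain ⟨s, hs, hlim⟩ := mem_closure_iff_seq_limit.1 hy
  obtain ⟨R, hR⟩ := hlim.norm.bddAbove_range
  -- The error bound from the point `0` provides preimages of norm at most `C * ‖s i‖`, so a
  -- subsequence of them converges.
  have hc : ∀ i, ∃ c : Fin k → ℝ, 0 ≤ c ∧ B c = s i ∧ ‖c‖ ≤ C * R := by
    intro i
    obtain ⟨c₀, hc₀, hBc⟩ := hs i
    obtain ⟨c, hc, hBc', -, hn⟩ := H (s i) 0 ⟨c₀, hc₀, hBc, by simp⟩ 0 (le_refl (0 : Fin k → ℝ))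
    refine ⟨c, hc, hBc', ?_⟩
    have hRi : ‖s i‖ ≤ R := hR ⟨i, rfl⟩
    simp only [map_zero, zero_sub, norm_neg, sub_zero, max_self, add_zero] at hn
    exact hn.trans (by gcongr)
  choose c hc0 hcB hcn using hc
  obtain ⟨c', -, φ, hφ, hlim'⟩ := (isCompact_closedBall (0 : Fin k → ℝ) (C * R)).tendsto_subseq
    (x := c) fun i => by simpa using hcn i
  refine ⟨c', ge_of_tendsto' hlim' fun i => hc0 _, ?_⟩
  refine tendsto_nhds_unique ((hB.tendsto c').comp hlim') ?_
  have : B ∘ c ∘ φ = s ∘ φ := funext fun i => hcB _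
  rw [this]
  exact hlim.comp hφ.tendsto_atTop

end Hoffman

/-! ### Growth of the two kinds of loss. -/

section Loss

/-- First-order lower bound for a strongly convex function. -/
theorem StrongConvexOn.add_fderiv_le {E : Type*} [NormedAddCommGroup E] [NormedSpace ℝ E]
    {s : Set E} {σ : ℝ} {f : E → ℝ} (hf : StrongConvexOn s σ f) {x y : E} (hx : x ∈ s)
    (hy : y ∈ s) {f' : E →L[ℝ] ℝ} (hd : HasFDerivAt f f' x) :
    f x + f' (y - x) + σ / 2 * ‖y - x‖ ^ 2 ≤ f y := by
  have h1 : Tendsto (fun t : ℝ => t⁻¹ • (f (x + t • (y - x)) - f x)) (𝓝[>] 0)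
      (𝓝 (f' (y - x))) := (hd.hasLineDerivAt (y - x)).tendsto_slope_zero_right
  have h2 : Tendsto (fun t : ℝ => f y - f x - (1 - t) * (σ / 2 * ‖y - x‖ ^ 2)) (𝓝[>] 0)
      (𝓝 (f y - f x - (1 - 0) * (σ / 2 * ‖y - x‖ ^ 2))) := by
    refine Tendsto.mono_left (Continuous.tendsto ?_ 0) nhdsWithin_le_nhds
    fun_prop
  have h3 : ∀ᶠ t : ℝ in 𝓝[>] 0, t⁻¹ • (f (x + t • (y - x)) - f x) ≤
      f y - f x - (1 - t) * (σ / 2 * ‖y - x‖ ^ 2) := by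
    filter_upwards [Ioo_mem_nhdsGT (zero_lt_one' ℝ)] with t ht
    have h := hf.2 hx hy (sub_nonneg.2 ht.2.le) ht.1.le (sub_add_cancel 1 t)
    have he : (1 - t) • x + t • y = x + t • (y - x) := by module
    rw [he, norm_sub_rev] at h
    simp only [smul_eq_mul] at h ⊢
    rw [inv_mul_le_iff₀ ht.1]
    linarith
  have := le_of_tendsto_of_tendsto h1 h2 h3
  linarith

/-- The behaviour of `l` at `y₀` that yields the Kurdyka–Łojasiewicz exponent `1 / 2` after adding
a polyhedral function: `l` is differentiable from above at `y₀`, agrees with its linearization on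
a translated finitely generated cone, and grows quadratically with the distance to it. -/
def HasPolyhedralGrowthAt {m : ℕ} (l : EuclideanSpace ℝ (Fin m) → EReal)
    (y₀ : EuclideanSpace ℝ (Fin m)) : Prop :=
  ∃ (L : ℝ) (g c : EuclideanSpace ℝ (Fin m)) (k : ℕ)
    (B : (Fin k → ℝ) →ₗ[ℝ] EuclideanSpace ℝ (Fin m)) (σ : ℝ), 0 < σ ∧ l y₀ = L ∧
    (∀ t, 0 ≤ t → l (c + B t) ≤ ((L + inner ℝ g (c + B t - y₀) : ℝ) : EReal)) ∧
    (∀ᶠ y in 𝓝 y₀, ∃ t, 0 ≤ t ∧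
      ((L + inner ℝ g (y - y₀) + σ * ‖y - (c + B t)‖ ^ 2 : ℝ) : EReal) ≤ l y) ∧
    ∀ ε : ℝ, 0 < ε → ∀ᶠ y in 𝓝 y₀,
      l y ≤ ((L + inner ℝ g (y - y₀) + ε * ‖y - y₀‖ : ℝ) : EReal)

/-- Here the cone is trivial (`k = 0`, `c = y₀`): strong convexity on a ball in the domain gives
growth away from `y₀` itself. -/
theorem IsLocallyStronglyConvexLoss.hasPolyhedralGrowthAt {m : ℕ}
    {l : EuclideanSpace ℝ (Fin m) → EReal} (hl : IsLocallyStronglyConvexLoss l)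
    {y₀ : EuclideanSpace ℝ (Fin m)} (hy₀ : l y₀ < ⊤) : HasPolyhedralGrowthAt l y₀ := by
  obtain ⟨⟨-, hbot⟩, -, -, hopen, hsc, hC2⟩ := hl
  have hmem : effDom l ∈ 𝓝 y₀ := hopen.mem_nhds hy₀
  set f : EuclideanSpace ℝ (Fin m) → ℝ := fun y => (l y).toReal with hf
  have hlf : ∀ y ∈ effDom l, l y = (f y : EReal) := fun y hy =>
    (EReal.coe_toReal (ne_of_lt hy) (hbot y)).symm
  have hd : HasFDerivAt f (fderiv ℝ f y₀) y₀ :=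
    ((hC2.contDiffAt hmem).differentiableAt (by norm_num)).hasFDerivAt
  set g := (InnerProductSpace.toDual ℝ (EuclideanSpace ℝ (Fin m))).symm (fderiv ℝ f y₀)
  have hg : ∀ v, inner ℝ g v = fderiv ℝ f y₀ v := fun v =>
    InnerProductSpace.toDual_symm_apply
  obtain ⟨R, hR, hball⟩ := Metric.nhds_basis_closedBall.mem_iff.1 hmem
  obtain ⟨σ, hσ, hstrong⟩ := hsc _ hball (isCompact_closedBall y₀ R) (convex_closedBall y₀ R)
  refine ⟨f y₀, g, y₀, 0, 0, σ / 2, by positivity, hlf _ hy₀, fun t _ => ?_, ?_, fun ε hε => ?_⟩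
  · simp [hlf _ hy₀]
  · filter_upwards [Metric.closedBall_mem_nhds y₀ hR] with y hy
    refine ⟨0, le_rfl, ?_⟩
    rw [hlf y (hball hy), EReal.coe_le_coe_iff, hg, map_zero, add_zero]
    exact hstrong.add_fderiv_le (Metric.mem_closedBall_self hR.le) hy hd
  · filter_upwards [hmem, hd.isLittleO.def hε] with y hy h
    rw [hlf y hy, EReal.coe_le_coe_iff, hg]
    have := (le_abs_self _).trans h
    linarith

theorem sub_le_of_lipschitzWith_fderiv {E : Type*} [NormedAddCommGroup E] [NormedSpace ℝ E]
    {q : E → ℝ} (hq : Differentiable ℝ q) {L : NNReal} (hL : LipschitzWith L (fderiv ℝ q))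
    (z v : E) : q (z + v) ≤ q z + fderiv ℝ q z v + L * ‖v‖ ^ 2 := by
  have h := (convex_closedBall z ‖v‖).norm_image_sub_le_of_norm_fderiv_le' (𝕜 := ℝ)
    (f := q) (φ := fderiv ℝ q z) (C := L * ‖v‖) (x := z) (y := z + v) (fun x _ => hq x)
    (fun x hx => (hL.norm_sub_le x z).trans (by
      gcongr
      simpa [dist_eq_norm] using hx)) (by simp) (by simp)
  rw [add_sub_cancel_left] at h
  have := (le_abs_self _).trans h
  nlinarith

/-- With `z₀` a maximizer at `y₀` and `G = ∇q z₀`, the points that keep `z₀` as maximizer include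
`G` plus the normal cone of `D` at `z₀`, where `l` is affine with slope `z₀`. Off this set, moving
`z₀` along the residual of the projection of `y - G` onto the cone improves the value quadratically.
-/
theorem IsConjugateTypeLoss.hasPolyhedralGrowthAt {m : ℕ}
    {l : EuclideanSpace ℝ (Fin m) → EReal} (hl : IsConjugateTypeLoss l)
    (y₀ : EuclideanSpace ℝ (Fin m)) : HasPolyhedralGrowthAt l y₀ := by
  obtain ⟨D, q, ⟨k, α, b, rfl⟩, ⟨σ, hσ, hsc⟩, hq, ⟨L, hL⟩, hmax⟩ := hl
  obtain ⟨z₀, hz₀, hlz₀⟩ := (hmax y₀).1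
  have hge : ∀ y z, (∀ j, α j z ≤ b j) → ((inner ℝ y z - q z : ℝ) : EReal) ≤ l y :=
    fun y z hz => (hmax y).2 ⟨z, hz, rfl⟩
  set G := (InnerProductSpace.toDual ℝ (EuclideanSpace ℝ (Fin m))).symm (fderiv ℝ q z₀)
  have hG : ∀ v, fderiv ℝ q z₀ v = inner ℝ G v := fun v =>
    InnerProductSpace.toDual_symm_apply.symm
  have hup : ∀ v, q (z₀ + v) ≤ q z₀ + inner ℝ G v + L * ‖v‖ ^ 2 := fun v =>
    hG v ▸ sub_le_of_lipschitzWith_fderiv hq hL z₀ v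
  have hlow : ∀ z, q z₀ + inner ℝ G (z - z₀) + σ / 2 * ‖z - z₀‖ ^ 2 ≤ q z := fun z =>
    hG (z - z₀) ▸ hsc.add_fderiv_le (Set.mem_univ _) (Set.mem_univ z) (hq z₀).hasFDerivAt
  -- First-order optimality of `z₀`: compare with points on the segment towards `z`, divide by `t`
  -- and let `t → 0`.
  have hopt : ∀ z, (∀ j, α j z ≤ b j) → inner ℝ (y₀ - G) (z - z₀) ≤ 0 := by
    intro z hz
    have h1 : Tendsto (fun t : ℝ => L * t * ‖z - z₀‖ ^ 2) (𝓝[>] 0)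
        (𝓝 (L * 0 * ‖z - z₀‖ ^ 2)) := by
      refine Tendsto.mono_left (Continuous.tendsto ?_ 0) nhdsWithin_le_nhds
      fun_prop
    rw [mul_zero, zero_mul] at h1
    refine ge_of_tendsto h1 ?_
    filter_upwards [Ioo_mem_nhdsGT (zero_lt_one' ℝ)] with t ht
    have h2 : ∀ j, α j (z₀ + t • (z - z₀)) ≤ b j := fun j => by
      rw [map_add, map_smul, map_sub, smul_eq_mul]
      have := hz₀ j
      nlinarith [hz j, ht.1, ht.2, mul_le_mul_of_nonneg_left (hz j) ht.1.le,
        mul_le_mul_of_nonneg_left this (sub_nonneg.2 ht.2.le)]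
    have h3 := hge y₀ _ h2
    rw [← hlz₀, EReal.coe_le_coe_iff, inner_add_right, real_inner_smul_right] at h3
    have h4 := hup (t • (z - z₀))
    rw [real_inner_smul_right, norm_smul, Real.norm_of_nonneg ht.1.le] at h4
    rw [inner_sub_left]
    have h5 : t * (inner ℝ y₀ (z - z₀) - inner ℝ G (z - z₀)) ≤ t * (L * t * ‖z - z₀‖ ^ 2) := by
      nlinarith
    exact le_of_mul_le_mul_left h5 ht.1
  -- Inactive normals are replaced by `0`, so that `B` maps the whole orthant onto the normal cone
  -- at `z₀`.
  let ν : Fin k → EuclideanSpace ℝ (Fin m) := fun j =>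
    if α j z₀ = b j then (InnerProductSpace.toDual ℝ (EuclideanSpace ℝ (Fin m))).symm
      (LinearMap.toContinuousLinearMap (α j)) else 0
  have hν : ∀ j v, inner ℝ (ν j) v = if α j z₀ = b j then α j v else 0 := by
    intro j v
    by_cases hj : α j z₀ = b j <;> simp [ν, hj]
  let B := Fintype.linearCombination ℝ ν
  have hB : ∀ t v, inner ℝ (B t) v = ∑ j, t j * inner ℝ (ν j) v := by
    intro t v
    simp only [B, Fintype.linearCombination_apply, sum_inner, real_inner_smul_left]
  obtain ⟨ρ, hρ, hfeas⟩ := exists_pos_forall_feasible_add α b hz₀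
  -- A step `s • v` gains at least `(s - L * s ^ 2) * ‖v‖ ^ 2`; this `s` makes the factor positive.
  set s : ℝ := 1 / (2 * (L + 1)) with hs
  have hL0 : (0 : ℝ) ≤ L := L.2
  have hs0 : 0 < s := by positivity
  have hsL : L * s ≤ 1 / 2 := by
    rw [hs, mul_one_div, div_le_div_iff₀ (by positivity) (by norm_num)]
    linarith
  have hs1 : s ≤ 1 := by
    rw [hs, div_le_one (by positivity)]
    linarith
  refine ⟨inner ℝ y₀ z₀ - q z₀, z₀, G, k, B, s * (1 - L * s), mul_pos hs0 (by linarith),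
    hlz₀.symm, fun t ht => ?_, ?_, fun ε hε => ?_⟩
  · obtain ⟨z, hz, hlz⟩ := (hmax (G + B t)).1
    rw [← hlz, EReal.coe_le_coe_iff]
    have h1 := hlow z
    have h2 : inner ℝ (B t) (z - z₀) ≤ 0 := by
      rw [hB]
      refine Finset.sum_nonpos fun j _ => mul_nonpos_of_nonneg_of_nonpos (ht j) ?_
      rw [hν]
      split_ifs with hj
      · rw [map_sub, hj]
        linarith [hz j]
      · exact le_rfl
    have h3 : 0 ≤ σ / 2 * ‖z - z₀‖ ^ 2 := by positivity
    rw [real_inner_comm]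
    simp only [inner_sub_right, inner_add_right] at h1 h2 ⊢
    rw [real_inner_comm (G) z, real_inner_comm (B t) z, real_inner_comm z₀ G,
      real_inner_comm z₀ (B t), real_inner_comm z₀ y₀] at *
    linarith
  · filter_upwards [Metric.closedBall_mem_nhds y₀ hρ] with y hy
    rw [mem_closedBall_iff_norm] at hy
    have hNconv : Convex ℝ (B '' {t | 0 ≤ t}) := (convex_Ici (0 : Fin k → ℝ)).linear_image B
    obtain ⟨p, ⟨t, ht, rfl⟩, hmin⟩ := exists_norm_eq_iInf_of_complete_convex
      (K := B '' {t | 0 ≤ t}) ⟨0, 0, le_refl (0 : Fin k → ℝ), map_zero B⟩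
      (isClosed_image_nonneg B).isComplete hNconv (y - G)
    rw [norm_eq_iInf_iff_real_inner_le_zero hNconv ⟨t, ht, rfl⟩] at hmin
    have hadd : ∀ t', 0 ≤ t + t' → inner ℝ (y - G - B t) (B t') ≤ 0 := fun t' ht' => by
      have := hmin _ ⟨t + t', ht', rfl⟩
      rwa [map_add, add_sub_cancel_left] at this
    set v := y - G - B t with hv
    have hvp : inner ℝ v (B t) = 0 := by
      refine le_antisymm (hadd t (add_nonneg ht ht)) ?_
      have := hadd (-t) (by simp)
      rw [map_neg, inner_neg_right] at this
      linarith
    have hvv : inner ℝ (y - G) v = ‖v‖ ^ 2 := by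
      have : y - G = v + B t := by rw [hv]; abel
      rw [this, inner_add_left, real_inner_comm v (B t), hvp, add_zero, real_inner_self_eq_norm_sq]
    have hact : ∀ j, α j z₀ = b j → α j v ≤ 0 := by
      intro j hj
      have h1 := hadd (Pi.single j 1) (add_nonneg ht (by simp))
      rw [real_inner_comm, hB, Finset.sum_eq_single j (fun i _ hi => by simp [hi]) (by simp),
        hν, if_pos hj] at h1
      simpa using h1
    have hw₀ : inner ℝ (y₀ - G) v ≤ 0 := by
      have hr : 0 < ρ / (‖v‖ + 1) := by positivity
      have h1 := hopt (z₀ + (ρ / (‖v‖ + 1)) • v) (hfeas _ (fun j hj => by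
        rw [map_smul, smul_eq_mul]
        exact mul_nonpos_of_nonneg_of_nonpos hr.le (hact j hj)) (by
        rw [norm_smul, Real.norm_of_nonneg hr.le, div_mul_eq_mul_div,
          div_le_iff₀ (by positivity)]
        gcongr
        linarith))
      rw [add_sub_cancel_left, real_inner_smul_right] at h1
      exact nonpos_of_mul_nonpos_right h1 hr
    -- This keeps `z₀ + s • v` within the feasible radius `ρ` when `y` is near `y₀`.
    have hvle : ‖v‖ ≤ ‖y - y₀‖ := by
      have h1 : inner ℝ (y - G) v = inner ℝ (y - y₀) v + inner ℝ (y₀ - G) v := by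
        rw [← inner_add_left, sub_add_sub_cancel]
      have h2 := real_inner_le_norm (y - y₀) v
      by_contra! h
      nlinarith [norm_nonneg (y - y₀)]
    have hsv : ∀ j, α j (z₀ + s • v) ≤ b j := by
      refine hfeas _ (fun j hj => ?_) ?_
      · rw [map_smul, smul_eq_mul]
        exact mul_nonpos_of_nonneg_of_nonpos hs0.le (hact j hj)
      · rw [norm_smul, Real.norm_of_nonneg hs0.le]
        nlinarith [norm_nonneg v]
    refine ⟨t, ht, le_trans ?_ (hge y _ hsv)⟩
    rw [EReal.coe_le_coe_iff, ← sub_sub, ← hv]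
    have h1 := hup (s • v)
    rw [norm_smul, Real.norm_of_nonneg hs0.le, real_inner_smul_right] at h1
    rw [inner_sub_left] at hvv
    rw [inner_sub_right, real_inner_comm y z₀, real_inner_comm y₀ z₀, inner_add_right,
      real_inner_smul_right]
    have h2 : s * inner ℝ y v - s * inner ℝ G v = s * ‖v‖ ^ 2 := by rw [← mul_sub, hvv]
    linarith
  -- Young's inequality leaves the error `‖y - y₀‖ ^ 2 / (2 * σ)`, which this radius makes at most
  -- `ε * ‖y - y₀‖`.
  · filter_upwards [Metric.closedBall_mem_nhds y₀ (show 0 < 2 * σ * ε by positivity)] with y hy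
    rw [mem_closedBall_iff_norm] at hy
    obtain ⟨z, hz, hlz⟩ := (hmax y).1
    rw [← hlz, EReal.coe_le_coe_iff]
    have h1 := hlow z
    have h2 := hopt z hz
    have h3 : inner ℝ (y - y₀) (z - z₀) ≤ ‖y - y₀‖ * ‖z - z₀‖ := real_inner_le_norm _ _
    have h4 : ‖y - y₀‖ * ‖z - z₀‖ ≤ ε * ‖y - y₀‖ + σ / 2 * ‖z - z₀‖ ^ 2 := by
      have h5 : ‖y - y₀‖ * ‖z - z₀‖ ≤ ‖y - y₀‖ ^ 2 / (2 * σ) + σ / 2 * ‖z - z₀‖ ^ 2 := by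
        have h7 : ‖y - y₀‖ ^ 2 / (2 * σ) + σ / 2 * ‖z - z₀‖ ^ 2 - ‖y - y₀‖ * ‖z - z₀‖ =
          (‖y - y₀‖ - σ * ‖z - z₀‖) ^ 2 / (2 * σ) := by field_simp; ring
        have h8 : 0 ≤ (‖y - y₀‖ - σ * ‖z - z₀‖) ^ 2 / (2 * σ) := by positivity
        linarith
      have h6 : ‖y - y₀‖ ^ 2 / (2 * σ) ≤ ε * ‖y - y₀‖ := by
        rw [div_le_iff₀ (by positivity)]
        nlinarith [norm_nonneg (y - y₀)]
      linarith
    rw [real_inner_comm (y - y₀) z₀]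
    simp only [inner_sub_left, inner_sub_right] at h1 h2 h3 ⊢
    linarith

end Loss

/-! ### Convex functions and subgradients of finite minima. -/

section ConvexFun

theorem EReal.exists_coe_of_add_ne_top {p q : EReal} (hp : p ≠ ⊥) (hq : q ≠ ⊥)
    (h : p + q ≠ ⊤) : ∃ a b : ℝ, p = a ∧ q = b := by
  induction p <;> induction q <;> simp_all

theorem IsConvexFun.le_combo {E : Type*} [AddCommGroup E] [Module ℝ E] {F : E → EReal}
    (hF : IsConvexFun F) {x y : E} {a b s t : ℝ} (hx : F x ≤ a) (hy : F y ≤ b) (hs : 0 ≤ s)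
    (ht : 0 ≤ t) (hst : s + t = 1) : F (s • x + t • y) ≤ ((s * a + t * b : ℝ) : EReal) :=
  hF (x := (x, a)) hx (y := (y, b)) hy hs ht hst

theorem IsConvexFun.comp_linearMap_add {E E' : Type*} [AddCommGroup E] [Module ℝ E]
    [AddCommGroup E'] [Module ℝ E'] {l : E' → EReal} {r : E → EReal} (hl : IsConvexFun l)
    (hr : IsConvexFun r) (hl' : ∀ y, l y ≠ ⊥) (hr' : ∀ x, r x ≠ ⊥) (T : E →ₗ[ℝ] E') :
    IsConvexFun fun x => l (T x) + r x := by
  rintro ⟨x, a⟩ hx ⟨y, b⟩ hy s t hs ht hst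
  simp only [epiGraph, Set.mem_ofPred_eq] at hx hy
  obtain ⟨p, p', hp, hp'⟩ := EReal.exists_coe_of_add_ne_top (hl' _) (hr' _)
    (ne_top_of_le_ne_top (EReal.coe_ne_top a) hx)
  obtain ⟨q, q', hq, hq'⟩ := EReal.exists_coe_of_add_ne_top (hl' _) (hr' _)
    (ne_top_of_le_ne_top (EReal.coe_ne_top b) hy)
  rw [hp, hp', ← EReal.coe_add, EReal.coe_le_coe_iff] at hx
  rw [hq, hq', ← EReal.coe_add, EReal.coe_le_coe_iff] at hy
  have h1 := hl.le_combo hp.le hq.le hs ht hst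
  have h2 := hr.le_combo hp'.le hq'.le hs ht hst
  change l (T (s • x + t • y)) + r (s • x + t • y) ≤ ((s * a + t * b : ℝ) : EReal)
  rw [map_add, map_smul, map_smul]
  refine (add_le_add h1 h2).trans ?_
  rw [← EReal.coe_add, EReal.coe_le_coe_iff]
  nlinarith [mul_le_mul_of_nonneg_left hx hs, mul_le_mul_of_nonneg_left hy ht]

/-- Convexity along the segment from `x` to `y` turns the local inequality into a global one. -/
theorem IsConvexFun.subgradient_of_mem_regularSubdiff {E : Type*} [NormedAddCommGroup E]
    [InnerProductSpace ℝ E] {F : E → EReal} (hF : IsConvexFun F) (hbot : ∀ y, F y ≠ ⊥) {x v : E}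
    (hv : v ∈ regularSubdiff F x) (y : E) :
    (((F x).toReal + inner ℝ v (y - x) : ℝ) : EReal) ≤ F y := by
  obtain ⟨htop, -, h⟩ := hv
  by_cases hy : F y = ⊤
  · simp [hy]
  lift F x to ℝ using ⟨htop, hbot x⟩ with a ha
  lift F y to ℝ using ⟨hy, hbot y⟩ with b hb
  rw [EReal.toReal_coe] at h ⊢
  rw [EReal.coe_le_coe_iff]
  refine le_of_forall_pos_le_add fun ε hε => ?_
  have hδ : 0 < ε / (‖y - x‖ + 1) := by positivity
  have hc : Tendsto (fun t : ℝ => x + t • (y - x)) (𝓝[>] 0) (𝓝 x) := by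
    have : Tendsto (fun t : ℝ => x + t • (y - x)) (𝓝 0) (𝓝 (x + (0 : ℝ) • (y - x))) :=
      Continuous.tendsto (by fun_prop) 0
    rw [zero_smul, add_zero] at this
    exact this.mono_left nhdsWithin_le_nhds
  obtain ⟨t, h1, ht⟩ := ((hc.eventually (h _ hδ)).and (Ioo_mem_nhdsGT (zero_lt_one' ℝ))).exists
  have h2 := hF.le_combo ha.ge hb.ge (sub_nonneg.2 ht.2.le) ht.1.le (sub_add_cancel 1 t)
  have he : (1 - t) • x + t • y = x + t • (y - x) := by module
  rw [he] at h2
  have h3 := h1.trans h2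
  rw [EReal.coe_le_coe_iff, add_sub_cancel_left, norm_smul, real_inner_smul_right,
    Real.norm_of_nonneg ht.1.le] at h3
  have h4 : ε / (‖y - x‖ + 1) * ‖y - x‖ ≤ ε := by
    rw [div_mul_eq_mul_div, div_le_iff₀ (by positivity)]
    nlinarith
  have h5 : t * (a + inner ℝ v (y - x)) ≤ t * (b + ε / (‖y - x‖ + 1) * ‖y - x‖) := by linarith
  linarith [le_of_mul_le_mul_left h5 ht.1]

/-- A limiting subgradient of a finite minimum of closed convex functions is a subgradient of one
of the active functions. -/
theorem exists_active_subgradient {E : Type*} [NormedAddCommGroup E] [InnerProductSpace ℝ E]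
    {N : ℕ} {F : Fin N → E → EReal} {u : E → EReal} (hu : ∀ x, u x = ⨅ i, F i x)
    (hconv : ∀ i, IsConvexFun (F i)) (hlsc : ∀ i, LowerSemicontinuous (F i))
    (hbot : ∀ i x, F i x ≠ ⊥) {x g : E} (hg : g ∈ limitingSubdiff u x) :
    ∃ i, F i x = u x ∧ ∀ y, (((u x).toReal + inner ℝ g (y - x) : ℝ) : EReal) ≤ F i y := by
  obtain ⟨htop, hxbot, xs, vs, hxs, huxs, hvs, hvlim⟩ := hg
  have hact : ∀ k, ∃ i, F i (xs k) = u (xs k) := by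
    intro k
    have hne : Nonempty (Fin N) := by
      by_contra h
      rw [not_nonempty_iff] at h
      exact (hvs k).1 (by rw [hu, iInf_of_empty])
    rw [hu]
    exact exists_eq_ciInf_of_finite
  choose idx hidx using hact
  -- Pigeonhole: one index is active infinitely often, so a subsequence stays with a single piece.
  have hfreq : ∃ i, ∃ᶠ k in atTop, idx k = i := by
    by_contra! h
    obtain ⟨k, hk⟩ := (eventually_all.2 h).exists
    exact hk _ rfl
  obtain ⟨i, hi⟩ := hfreq
  obtain ⟨φ, hφ, hφi⟩ := extraction_of_frequently_atTop hi
  have hxφ := hxs.comp hφ.tendsto_atTop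
  have huφ := huxs.comp hφ.tendsto_atTop
  have hvφ := hvlim.comp hφ.tendsto_atTop
  have hFi : ∀ k, F i (xs (φ k)) = u (xs (φ k)) := fun k => hφi k ▸ hidx (φ k)
  refine ⟨i, le_antisymm ?_ (hu x ▸ iInf_le _ i), fun y => ?_⟩
  · by_contra! h
    obtain ⟨c, hc1, hc2⟩ := exists_between h
    obtain ⟨k, hk1, hk2⟩ :=
      ((hxφ.eventually (hlsc i x c hc2)).and (huφ.eventually_lt_const hc1)).exists
    simp only [Function.comp_apply, hFi] at hk1 hk2
    exact lt_asymm hk1 hk2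
  · by_cases hy : F i y = ⊤
    · simp [hy]
    have hsub : ∀ k, (((u (xs (φ k))).toReal + inner ℝ (vs (φ k)) (y - xs (φ k)) : ℝ) : EReal) ≤
        F i y := by
      intro k
      obtain ⟨h1, h2, h3⟩ := hvs (φ k)
      rw [← hFi]
      -- Since `F i ≥ u` with equality at the base point, regular subgradients of `u` there are also
      -- regular for `F i`.
      refine (hconv i).subgradient_of_mem_regularSubdiff (hbot i)
        ⟨(hFi k).symm ▸ h1, hbot i _, fun ε hε => ?_⟩ y
      rw [hFi]
      exact (h3 ε hε).mono fun z hz => hz.trans (hu z ▸ iInf_le _ i)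
    lift F i y to ℝ using ⟨hy, hbot i y⟩ with b hb
    simp only [EReal.coe_le_coe_iff] at hsub ⊢
    refine le_of_tendsto' (Tendsto.add ((EReal.tendsto_toReal htop hxbot).comp huφ)
      (Filter.Tendsto.inner hvφ (tendsto_const_nhds.sub hxφ))) fun k => hsub k

end ConvexFun

/-! ### Distance to the minimizers of one piece. -/

section Growth

variable {m n : ℕ} {l : EuclideanSpace ℝ (Fin m) → EReal} {r : EuclideanSpace ℝ (Fin n) → EReal}
  {T : EuclideanSpace ℝ (Fin n) →ₗ[ℝ] EuclideanSpace ℝ (Fin m)}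

/-- Fermat's rule for the sum of a function differentiable from above and a convex function. -/
theorem le_add_inner_of_forall_le {L ρ₀ : ℝ} {g : EuclideanSpace ℝ (Fin m)}
    {x₀ : EuclideanSpace ℝ (Fin n)} (hr : IsConvexFun r) (hr₀ : r x₀ = ρ₀)
    (hdiff : ∀ ε : ℝ, 0 < ε → ∀ᶠ y in 𝓝 (T x₀),
      l y ≤ ((L + inner ℝ g (y - T x₀) + ε * ‖y - T x₀‖ : ℝ) : EReal))
    (hmin : ∀ x, ((L + ρ₀ : ℝ) : EReal) ≤ l (T x) + r x)
    {x : EuclideanSpace ℝ (Fin n)} {ρ : ℝ} (hx : r x ≤ ρ) :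
    ρ₀ ≤ ρ + inner ℝ g (T x - T x₀) := by
  refine le_of_forall_pos_le_add fun ε hε => ?_
  have hδ : 0 < ε / (‖T x - T x₀‖ + 1) := by positivity
  have hT : Continuous T := T.continuous_of_finiteDimensional
  have hc : Tendsto (fun t : ℝ => T (x₀ + t • (x - x₀))) (𝓝[>] 0) (𝓝 (T x₀)) := by
    have : Tendsto (fun t : ℝ => T (x₀ + t • (x - x₀))) (𝓝 0)
      (𝓝 (T (x₀ + (0 : ℝ) • (x - x₀)))) := Continuous.tendsto (by fun_prop) 0
    rw [zero_smul, add_zero] at this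
    exact this.mono_left nhdsWithin_le_nhds
  obtain ⟨t, h1, ht⟩ :=
    ((hc.eventually (hdiff _ hδ)).and (Ioo_mem_nhdsGT (zero_lt_one' ℝ))).exists
  have h2 := hr.le_combo hr₀.le hx (sub_nonneg.2 ht.2.le) ht.1.le (sub_add_cancel 1 t)
  have he : (1 - t) • x₀ + t • x = x₀ + t • (x - x₀) := by module
  rw [he] at h2
  have h3 := (hmin _).trans (add_le_add h1 h2)
  rw [← EReal.coe_add, EReal.coe_le_coe_iff, map_add, add_sub_cancel_left, map_smul, map_sub,
    norm_smul, real_inner_smul_right, Real.norm_of_nonneg ht.1.le] at h3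
  have h4 : ε / (‖T x - T x₀‖ + 1) * ‖T x - T x₀‖ ≤ ε := by
    rw [div_mul_eq_mul_div, div_le_iff₀ (by positivity)]
    nlinarith
  have h5 : t * ρ₀ ≤ t * (ρ + inner ℝ g (T x - T x₀) +
      ε / (‖T x - T x₀‖ + 1) * ‖T x - T x₀‖) := by linarith
  linarith [le_of_mul_le_mul_left h5 ht.1]

/-- Near a minimizer, the distance to the set of minimizers is bounded by a multiple of the square
root of the excess over the minimum. -/
theorem HasPolyhedralGrowthAt.exists_norm_sub_le_sqrt {x₀ : EuclideanSpace ℝ (Fin n)}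
    (hl : HasPolyhedralGrowthAt l (T x₀)) (hl' : ∀ y, l y ≠ ⊥) (hr : IsPolyhedralFun r)
    (hr' : ∀ x, r x ≠ ⊥) {M : ℝ} (hM : l (T x₀) + r x₀ = M)
    (hmin : ∀ x, (M : EReal) ≤ l (T x) + r x) :
    ∃ K : ℝ, 0 < K ∧ ∀ᶠ x in 𝓝 x₀, ∀ e : ℝ, e ≤ 1 → l (T x) + r x = ((M + e : ℝ) : EReal) →
      ∃ x', l (T x') + r x' ≤ M ∧ ‖x - x'‖ ≤ K * √e := by
  obtain ⟨L, g, c, k, B, σ, hσ, hL, hpiece, hgrow, hdiff⟩ := hl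
  obtain ⟨-, ρ₀, -, hρ₀⟩ := EReal.exists_coe_of_add_ne_top (hl' (T x₀)) (hr' x₀)
    (by rw [hM]; exact EReal.coe_ne_top M)
  have hMeq : M = L + ρ₀ := by
    rw [hL, hρ₀, ← EReal.coe_add, EReal.coe_eq_coe_iff] at hM
    exact hM.symm
  have hfermat : ∀ {x ρ}, r x ≤ ((ρ : ℝ) : EReal) → ρ₀ ≤ ρ + inner ℝ g (T x - T x₀) :=
    le_add_inner_of_forall_le hr.convex hρ₀ hdiff (hMeq ▸ hmin)
  have hT : Continuous T := T.continuous_of_finiteDimensional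
  let X := (EuclideanSpace ℝ (Fin n) × ℝ) × (Fin k → ℝ)
  let πx : X →ₗ[ℝ] EuclideanSpace ℝ (Fin n) := LinearMap.fst ℝ _ _ ∘ₗ LinearMap.fst ℝ _ _
  let πρ : X →ₗ[ℝ] ℝ := LinearMap.snd ℝ _ _ ∘ₗ LinearMap.fst ℝ _ _
  -- The polyhedron of triples `(x, ρ, t)` with `r x ≤ ρ`, `0 ≤ t`, `T x = c + B t` and linearized
  -- objective at most its value at `x₀`; its `x`-components are minimizers.
  obtain ⟨C, hC, H⟩ := (IsPolyhedron.prod hr (isPolyhedron_nonneg k)).exists_error_bound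
    (T ∘ₗ πx - B ∘ₗ LinearMap.snd ℝ _ _) (πρ + (innerₗ _ g) ∘ₗ T ∘ₗ πx)
  -- Growth at `T x₀` itself forces `T x₀ = c + B t₀`, so that polyhedron is nonempty.
  obtain ⟨t₀, ht₀, hle₀⟩ := hgrow.self_of_nhds
  have hy₀ : T x₀ - B t₀ = c := by
    rw [hL, EReal.coe_le_coe_iff, sub_self, inner_zero_right, add_zero] at hle₀
    have h0 : ‖T x₀ - (c + B t₀)‖ ^ 2 ≤ 0 := by
      by_contra! h
      nlinarith
    have h1 : T x₀ - (c + B t₀) = 0 := by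
      rw [← norm_eq_zero]
      exact pow_eq_zero_iff two_ne_zero |>.1 (le_antisymm h0 (by positivity))
    rw [sub_eq_zero.1 h1, add_sub_cancel_right]
  refine ⟨C * (√(1 / σ) + 1), by positivity, ?_⟩
  filter_upwards [(hT.tendsto x₀).eventually hgrow] with x hx e he1 hFx
  obtain ⟨t, ht, hlow⟩ := hx
  obtain ⟨τ, ρ, hτ, hρ⟩ := EReal.exists_coe_of_add_ne_top (hl' (T x)) (hr' x)
    (by rw [hFx]; exact EReal.coe_ne_top _)
  rw [hτ, hρ, ← EReal.coe_add, EReal.coe_eq_coe_iff] at hFx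
  rw [hτ, EReal.coe_le_coe_iff] at hlow
  have hh := hfermat hρ.le
  obtain ⟨⟨⟨x', ρ'⟩, t'⟩, ⟨hx', ht'⟩, hc', hβ', hn⟩ := H c (ρ₀ + inner ℝ g (T x₀))
    ⟨((x₀, ρ₀), t₀), ⟨hρ₀.le, ht₀⟩, hy₀, le_rfl⟩ ((x, ρ), t) ⟨hρ.le, ht⟩
  simp only [LinearMap.sub_apply, LinearMap.add_apply, LinearMap.comp_apply, LinearMap.fst_apply,
    LinearMap.snd_apply, innerₗ_apply_apply, πx, πρ] at hc' hβ' hn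
  have hx'B : T x' = c + B t' := by rw [← hc', sub_add_cancel]
  refine ⟨x', ?_, ?_⟩
  · have h1 := hpiece t' ht'
    rw [← hx'B] at h1
    refine (add_le_add h1 hx').trans ?_
    rw [← EReal.coe_add, EReal.coe_le_coe_iff, hMeq, inner_sub_right]
    linarith
  · set h : ℝ := ρ + inner ℝ g (T x - T x₀) - ρ₀ with hhdef
    have h0 : 0 ≤ h := by linarith
    have hmax : max (ρ + inner ℝ g (T x) - (ρ₀ + inner ℝ g (T x₀))) 0 = h := by
      rw [max_eq_left] <;> rw [hhdef, inner_sub_right] at * <;> linarith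
    -- The excess `e` dominates both residuals: the cone one squared, the linear one `h` to first
    -- order. As `e ≤ 1`, both are `O(√e)`.
    have hres : σ * ‖T x - (c + B t)‖ ^ 2 + h ≤ e := by linarith
    have he0 : 0 ≤ e := le_trans (by positivity) hres
    have hhe : h ≤ √e := by
      refine Real.le_sqrt_of_sq_le ?_
      have : h ≤ e := le_trans (by linarith [show 0 ≤ σ * ‖T x - (c + B t)‖ ^ 2 by positivity])
        hres
      nlinarith
    have hre : ‖T x - (c + B t)‖ ≤ √(1 / σ) * √e := by
      rw [← Real.sqrt_mul (by positivity)]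
      refine Real.le_sqrt_of_sq_le ?_
      rw [one_div_mul_eq_div, le_div_iff₀ hσ]
      linarith
    have hfst : ‖x - x'‖ ≤ ‖(((x, ρ), t) : X) - ((x', ρ'), t')‖ :=
      (norm_fst_le (((x, ρ) : EuclideanSpace ℝ (Fin n) × ℝ) - (x', ρ'))).trans
        (norm_fst_le ((((x, ρ), t) : X) - ((x', ρ'), t')))
    rw [hmax, sub_sub, add_comm (B t)] at hn
    calc ‖x - x'‖ ≤ C * (‖T x - (c + B t)‖ + h) := hfst.trans hn
      _ ≤ C * (√(1 / σ) * √e + √e) := by gcongr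
      _ = _ := by ring

end Growth

/-! ### The inequality for one piece and for the minimum. -/

/-- The Kurdyka–Łojasiewicz inequality at `x₀` for the active pieces of a minimum of value `M`. -/
theorem exists_kl_bound_of_piece {E : Type*} [NormedAddCommGroup E] [InnerProductSpace ℝ E]
    {F : E → EReal} (hlsc : LowerSemicontinuous F) (hbot : ∀ x, F x ≠ ⊥) {x₀ : E} {M : ℝ}
    (hM : (M : EReal) ≤ F x₀)
    (hgrow : F x₀ = M → (∀ x, (M : EReal) ≤ F x) → ∃ K : ℝ, 0 < K ∧ ∀ᶠ x in 𝓝 x₀, ∀ e : ℝ,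
      e ≤ 1 → F x = ((M + e : ℝ) : EReal) → ∃ x', F x' ≤ M ∧ ‖x - x'‖ ≤ K * √e) :
    ∃ κ η : ℝ, 0 < κ ∧ 0 < η ∧ ∀ᶠ x in 𝓝 x₀, ∀ (s : ℝ) (g : E), F x = s → |s - M| < η →
      (∀ y, ((s + inner ℝ g (y - x) : ℝ) : EReal) ≤ F y) → κ * √|s - M| ≤ ‖g‖ := by
  rcases hM.lt_or_eq with hlt | heq
  · obtain ⟨c, hc1, hc2⟩ := EReal.lt_iff_exists_real_btwn.1 hlt
    rw [EReal.coe_lt_coe_iff] at hc1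
    refine ⟨1, c - M, one_pos, sub_pos.2 hc1, ?_⟩
    filter_upwards [hlsc x₀ c hc2] with x hx s g hs hη _
    rw [hs, gt_iff_lt, EReal.coe_lt_coe_iff] at hx
    linarith [le_abs_self (s - M)]
  by_cases hmin : ∀ x, (M : EReal) ≤ F x
  · obtain ⟨K, hK, H⟩ := hgrow heq.symm hmin
    refine ⟨K⁻¹, 1, by positivity, one_pos, ?_⟩
    filter_upwards [H] with x hx s g hs hη hsub
    have hsM : M ≤ s := by
      have := hmin x
      rwa [hs, EReal.coe_le_coe_iff] at this
    rw [abs_of_nonneg (sub_nonneg.2 hsM)] at hη ⊢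
    obtain ⟨x', hx', hn⟩ := hx (s - M) hη.le (by rw [hs, add_sub_cancel])
    have h1 := (hsub x').trans hx'
    rw [EReal.coe_le_coe_iff] at h1
    have h2 : -(inner ℝ g (x' - x)) ≤ ‖g‖ * ‖x - x'‖ := by
      rw [← inner_neg_right, neg_sub]
      exact real_inner_le_norm _ _
    have h3 : √(s - M) * √(s - M) ≤ ‖g‖ * (K * √(s - M)) := by
      rw [Real.mul_self_sqrt (sub_nonneg.2 hsM)]
      have := mul_le_mul_of_nonneg_left hn (norm_nonneg g)
      linarith
    rw [inv_mul_le_iff₀ hK]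
    rcases (Real.sqrt_nonneg (s - M)).eq_or_lt with h0 | h0
    · rw [← h0]
      positivity
    · refine le_of_mul_le_mul_right ?_ h0
      linarith
  · push Not at hmin
    obtain ⟨y, hy⟩ := hmin
    lift F y to ℝ using ⟨hy.ne_top, hbot y⟩ with b hb
    rw [EReal.coe_lt_coe_iff] at hy
    -- Half the gap: values within `η` of `M` still exceed `F y = b` by at least `η`, which bounds
    -- `‖g‖` below by `η / R`.
    set η := (M - b) / 2 with hη
    set R := ‖y - x₀‖ + 1 with hR
    have hη0 : 0 < η := by rw [hη]; linarith
    have hR0 : 0 < R := by positivity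
    refine ⟨η / (R * √η), η, by positivity, hη0, ?_⟩
    filter_upwards [Metric.closedBall_mem_nhds x₀ one_pos] with x hx s g hs hsη hsub
    rw [mem_closedBall_iff_norm] at hx
    have h1 := hsub y
    rw [← hb, EReal.coe_le_coe_iff] at h1
    have h2 : -(inner ℝ g (y - x)) ≤ ‖g‖ * R := by
      rw [← inner_neg_right]
      refine (real_inner_le_norm _ _).trans ?_
      rw [norm_neg]
      have : ‖y - x‖ ≤ R := by
        rw [← sub_add_sub_cancel y x₀ x]
        refine (norm_add_le _ _).trans ?_
        rw [norm_sub_rev x₀ x]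
        linarith
      gcongr
    have h3 : √|s - M| ≤ √η := Real.sqrt_le_sqrt hsη.le
    have h4 : η ≤ ‖g‖ * R := by linarith [(abs_lt.1 hsη).1]
    calc η / (R * √η) * √|s - M| ≤ η / (R * √η) * √η := by gcongr
      _ = η / R := by field_simp
      _ ≤ ‖g‖ := by rwa [div_le_iff₀ hR0]

theorem IsConjugateTypeLoss.isConvexFun {E : Type*} [NormedAddCommGroup E]
    [InnerProductSpace ℝ E] {l : E → EReal} (hl : IsConjugateTypeLoss l) : IsConvexFun l := by
  obtain ⟨D, q, -, -, -, -, hmax⟩ := hl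
  rintro ⟨x, a⟩ hx ⟨y, b⟩ hy s t hs ht hst
  refine (isLUB_le_iff (hmax _).isLUB).2 ?_
  rintro _ ⟨z, hz, rfl⟩
  have h1 : inner ℝ x z - q z ≤ a :=
    EReal.coe_le_coe_iff.1 (((hmax x).2 ⟨z, hz, rfl⟩).trans hx)
  have h2 : inner ℝ y z - q z ≤ b :=
    EReal.coe_le_coe_iff.1 (((hmax y).2 ⟨z, hz, rfl⟩).trans hy)
  change ((inner ℝ (s • x + t • y) z - q z : ℝ) : EReal) ≤ ((s * a + t * b : ℝ) : EReal)
  rw [EReal.coe_le_coe_iff, inner_add_left, real_inner_smul_left, real_inner_smul_left]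
  have h3 : q z = s * q z + t * q z := by rw [← add_mul, hst, one_mul]
  nlinarith [mul_le_mul_of_nonneg_left h1 hs, mul_le_mul_of_nonneg_left h2 ht]

theorem IsConjugateTypeLoss.isClosedFun {E : Type*} [NormedAddCommGroup E]
    [InnerProductSpace ℝ E] {l : E → EReal} (hl : IsConjugateTypeLoss l) : IsClosedFun l := by
  obtain ⟨D, q, -, -, -, -, hmax⟩ := hl
  intro y c hc
  obtain ⟨z, hz, hlz⟩ := (hmax y).1
  have hcont : Continuous fun y' : E => ((inner ℝ y' z - q z : ℝ) : EReal) :=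
    continuous_coe_real_ereal.comp (by fun_prop)
  rw [← hlz] at hc
  filter_upwards [(hcont.tendsto y).eventually_const_lt hc] with y' hy'
  exact hy'.trans_le ((hmax y').2 ⟨z, hz, rfl⟩)

theorem IsConjugateTypeLoss.ne_bot {E : Type*} [NormedAddCommGroup E]
    [InnerProductSpace ℝ E] {l : E → EReal} (hl : IsConjugateTypeLoss l) (y : E) : l y ≠ ⊥ := by
  obtain ⟨D, q, -, -, -, -, hmax⟩ := hl
  obtain ⟨z, -, hlz⟩ := (hmax y).1
  rw [← hlz]
  exact EReal.coe_ne_bot _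

theorem theorem3 {m n N : ℕ}
    (A : Matrix (Fin m) (Fin n) ℝ)
    (l : EuclideanSpace ℝ (Fin m) → EReal)
    (r : Fin N → EuclideanSpace ℝ (Fin n) → EReal)
    (u : EuclideanSpace ℝ (Fin n) → EReal)
    (hu : ∀ x, u x = ⨅ i : Fin N, (l (A.toEuclideanLin x) + r i x))
    (hu_proper : IsProperFun u)
    (hu_closed : IsClosedFun u)
    (hr : ∀ i, IsProperFun (r i) ∧ IsClosedFun (r i) ∧ IsPolyhedralFun (r i))
    (hl : IsLocallyStronglyConvexLoss l ∨ IsConjugateTypeLoss l)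
    (hu_cont : ContinuousOn u (domSubdiff u)) :
    IsTwoSidedKLFun u (1 / 2) := by
  obtain ⟨hlbot, hlclosed, hlconv, hlgrow⟩ : (∀ y, l y ≠ ⊥) ∧ IsClosedFun l ∧ IsConvexFun l ∧
      ∀ y, l y < ⊤ → HasPolyhedralGrowthAt l y := by
    rcases hl with hl | hl
    · exact ⟨hl.1.2, hl.2.1, hl.2.2.1, fun y hy => hl.hasPolyhedralGrowthAt hy⟩
    · exact ⟨hl.ne_bot, hl.isClosedFun, hl.isConvexFun, fun y _ => hl.hasPolyhedralGrowthAt y⟩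
  have hrbot : ∀ i x, r i x ≠ ⊥ := fun i => (hr i).1.2
  have hA : Continuous A.toEuclideanLin := LinearMap.continuous_of_finiteDimensional _
  have hconv : ∀ i, IsConvexFun fun x => l (A.toEuclideanLin x) + r i x := fun i =>
    hlconv.comp_linearMap_add (hr i).2.2.convex hlbot (hrbot i) _
  have hlsc : ∀ i, LowerSemicontinuous fun x => l (A.toEuclideanLin x) + r i x := fun i =>
    LowerSemicontinuous.add' (fun x c hc => hA.tendsto x |>.eventually (hlclosed _ c hc))
      (hr i).2.1 fun x => EReal.continuousAt_add (.inr (hrbot i x)) (.inl (hlbot _))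
  have hbot : ∀ i x, l (A.toEuclideanLin x) + r i x ≠ ⊥ := fun i x => by
    rw [Ne, EReal.add_eq_bot_iff, not_or]
    exact ⟨hlbot _, hrbot i x⟩
  refine ⟨hu_proper, hu_closed, by norm_num, by norm_num, fun x₀ hx₀ => ?_⟩
  obtain ⟨-, htop, -⟩ := hx₀
  refine ⟨htop.lt_top, ?_⟩
  obtain ⟨M, hM⟩ : ∃ M : ℝ, u x₀ = M :=
    ⟨_, (EReal.coe_toReal htop (hu_proper.2 x₀)).symm⟩
  have hpiece := fun i => exists_kl_bound_of_piece (hlsc i) (hbot i) (x₀ := x₀) (M := M)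
    (hM ▸ hu x₀ ▸ iInf_le _ i) fun h1 h2 => by
      have hlt : l (A.toEuclideanLin x₀) < ⊤ := by
        obtain ⟨a, -, ha, -⟩ := EReal.exists_coe_of_add_ne_top (hlbot _) (hrbot i x₀)
          (h1 ▸ EReal.coe_ne_top M)
        exact ha ▸ EReal.coe_lt_top a
      exact (hlgrow _ hlt).exists_norm_sub_le_sqrt hlbot (hr i).2.2 (hrbot i) h1 h2
  choose κ η hκ hη hkl using hpiece
  have hmin : ∀ ξ : Fin N → ℝ, (∀ i, 0 < ξ i) → ∃ c : ℝ, 0 < c ∧ ∀ i, c < ξ i := by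
    intro ξ hξ
    have h0 : ∀ᶠ c : ℝ in 𝓝[>] 0, 0 < c := self_mem_nhdsWithin
    obtain ⟨c, hc, h⟩ := (h0.and (eventually_all.2 fun i => Ioo_mem_nhdsGT (hξ i))).exists
    exact ⟨c, hc, fun i => (h i).2⟩
  obtain ⟨κ₀, hκ₀, hκle⟩ := hmin κ hκ
  obtain ⟨η₀, hη₀, hηle⟩ := hmin η hη
  refine ⟨_, eventually_all.2 hkl, κ₀, η₀, hκ₀, hη₀, fun x hx hlow hup g hg => ?_⟩
  obtain ⟨i, hi, hsub⟩ := exists_active_subgradient hu hconv hlsc hbot hg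
  obtain ⟨s, hs⟩ : ∃ s : ℝ, u x = s :=
    ⟨_, (EReal.coe_toReal hg.1 hg.2.1).symm⟩
  rw [hM, hs] at hlow hup ⊢
  rw [← EReal.coe_sub, EReal.coe_lt_coe_iff] at hlow
  rw [← EReal.coe_add, EReal.coe_lt_coe_iff] at hup
  rw [hs] at hsub hi
  rw [EReal.toReal_coe] at hsub
  rw [EReal.toReal_coe, EReal.toReal_coe, ← Real.sqrt_eq_rpow]
  refine le_trans ?_ (hx i s g hi (abs_lt.2 ⟨?_, ?_⟩) hsub)
  · gcongr
    exact (hκle i).le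
  · linarith [hηle i]
  · linarith [hηle i]
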